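/- All graphs are finite and simple. For a graph $G$, $\chi(G)$ is its chromatic number and $L(G)$ its line graph (the vertices are the edges of $G$; two distinct ones are adjacent iff they share an endpoint). A graph is chordal if it has no induced cycle of length more than three, an interval graph if it is the intersection graph of intervals on the real line, and an equivalence graph if it is a disjoint union of cliques. The chordal covering number $\mathrm{cc}(G)$, the track number $\tau(G)$ and the equivalence covering number $\mathrm{eq}(G)$ are the minimum numbers of, respectively, chordal graphs, interval graphs and equivalence graphs on the vertex set of $G$ whose union is $G$ (so each is $0$ if $G$ has no edges). Let $N(n,3)$ be the minimum size of a family of total orders of $\{1,\dots,n\}$ such that for every three distinct elements $a,b,c$ some order in the family places $a$ after both $b$ and $c$. Theorem. 1. For every sequence of graphs $(G_n)_{n\ge 1}$ with $\chi(G_n)\to\infty$, we have $\mathrm{cc}(L(G_n))\to\infty$ and $\tau(L(G_n))\to\infty$. 2. For every graph $G$ with $\chi(G)\neq 2$, $\mathrm{eq}(L(G))\le N(\chi(G),3)$. 3. For every family $\mathcal G$ of graphs, $\{\tau(L(G)) : G\in\mathcal G\}$ is bounded if and only if $\{\chi(G) : G\in\mathcal G\}$ is bounded. -/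

import Mathlib

universe u v

namespace LineCover

open SimpleGraph

variable {V : Type*}

/-- A graph is chordal if it has no induced cycle of length more than three. -/
def IsChordal (G : SimpleGraph V) : Prop :=
  ∀ n : ℕ, 4 ≤ n → IsEmpty (cycleGraph n ↪g G)

/-- A graph is an interval graph if it is the intersection graph of (closed, bounded, nonempty)
intervals on the real line. -/
def IsIntervalGraph (G : SimpleGraph V) : Prop :=
  ∃ l r : V → ℝ, (∀ v, l v ≤ r v) ∧
    ∀ u v, G.Adj u v ↔ u ≠ v ∧ (Set.Icc (l u) (r u) ∩ Set.Icc (l v) (r v)).Nonempty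

/-- A graph is an equivalence graph if it is a disjoint union of cliques: the vertex set is
partitioned into classes, and distinct vertices are adjacent iff they are in the same class. -/
def IsEquivalenceGraph (G : SimpleGraph V) : Prop :=
  ∃ s : Setoid V, ∀ u v, G.Adj u v ↔ u ≠ v ∧ s u v

/-- `k` graphs of the class `P` have union `G`. The graphs are taken on the whole vertex set of `G`
(isolated vertices are allowed), and their union is the supremum `⨆ i, H i`. -/
def HasCover (P : SimpleGraph V → Prop) (G : SimpleGraph V) (k : ℕ) : Prop :=
  ∃ H : Fin k → SimpleGraph V, (∀ i, P (H i)) ∧ ⨆ i, H i = G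

/-- The covering number of `G` with respect to the class `P`: the minimum number of graphs of
the class whose union is `G`. -/
noncomputable def coveringNumber (P : SimpleGraph V → Prop) (G : SimpleGraph V) : ℕ :=
  sInf {k | HasCover P G k}

/-- The chordal covering number `cc(G)`. -/
noncomputable def chordalCoveringNumber (G : SimpleGraph V) : ℕ :=
  coveringNumber IsChordal G

/-- The track number `τ(G)`. -/
noncomputable def trackNumber (G : SimpleGraph V) : ℕ :=
  coveringNumber IsIntervalGraph G

/-- The equivalence covering number `eq(G)`. -/
noncomputable def equivalenceCoveringNumber (G : SimpleGraph V) : ℕ :=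
  coveringNumber IsEquivalenceGraph G

/-- The chromatic number of a graph as a natural number (used for finite graphs only). -/
noncomputable def chi (G : SimpleGraph V) : ℕ :=
  G.chromaticNumber.toNat

/-- A family of total orders of `Fin n` is 3-suitable if for any three distinct elements
`a, b, c` some order of the family has `a` after both `b` and `c`. -/
def IsThreeSuitable {n k : ℕ} (σ : Fin k → LinearOrder (Fin n)) : Prop :=
  ∀ a b c : Fin n, a ≠ b → a ≠ c → b ≠ c → ∃ i, (σ i).lt b a ∧ (σ i).lt c a

/-- `N(n, 3)`: the size of a smallest 3-suitable family of total orders of an `n`-set. -/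
noncomputable def suitableNumber (n : ℕ) : ℕ :=
  sInf {k | ∃ σ : Fin k → LinearOrder (Fin n), IsThreeSuitable σ}

/-! The minima above are taken over nonempty sets, so none of them is a default value. -/

theorem coe_chi [Finite V] (G : SimpleGraph V) : (chi G : ℕ∞) = G.chromaticNumber := by
  have := Fintype.ofFinite V
  exact ENat.natCast_toNat
    (chromaticNumber_ne_top_iff_exists.2 ⟨_, G.colorable_of_fintype⟩)

theorem IsEquivalenceGraph.isChordal {G : SimpleGraph V} (h : IsEquivalenceGraph G) :
    IsChordal G := by
  obtain ⟨s, hs⟩ := h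
  intro n hn
  refine ⟨fun f => ?_⟩
  obtain ⟨m, rfl⟩ := Nat.exists_eq_add_of_le' hn
  have h01 : (cycleGraph (m + 4)).Adj ⟨0, by omega⟩ ⟨1, by omega⟩ := by
    simp [cycleGraph_adj']
  have h12 : (cycleGraph (m + 4)).Adj ⟨1, by omega⟩ ⟨2, by omega⟩ := by
    rw [cycleGraph_adj']
    right
    simp only [Fin.sub_def]
    rw [show m + 4 - 1 + 2 = 1 + (m + 4) by omega, Nat.add_mod_right, Nat.mod_eq_of_lt]
    omega
  have h02 : ¬ (cycleGraph (m + 4)).Adj ⟨0, by omega⟩ ⟨2, by omega⟩ := by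
    rw [cycleGraph_adj']
    simp only [Fin.sub_def, not_or]
    constructor
    · rw [Nat.mod_eq_of_lt] <;> omega
    · rw [show m + 4 - 0 + 2 = 2 + (m + 4) by omega, Nat.add_mod_right, Nat.mod_eq_of_lt] <;> omega
  have e1 := (hs _ _).1 (f.map_adj_iff.2 h01)
  have e2 := (hs _ _).1 (f.map_adj_iff.2 h12)
  refine h02 (f.map_adj_iff.1 ((hs _ _).2 ⟨fun h => ?_, s.trans e1.2 e2.2⟩))
  have := f.injective h
  simp at this

theorem IsEquivalenceGraph.isIntervalGraph [Finite V] {G : SimpleGraph V}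
    (h : IsEquivalenceGraph G) : IsIntervalGraph G := by
  obtain ⟨s, hs⟩ := h
  obtain ⟨f, hf⟩ := Countable.exists_injective_nat (Quotient s)
  refine ⟨fun v => f (Quotient.mk s v), fun v => f (Quotient.mk s v), fun _ => le_rfl, ?_⟩
  intro u v
  rw [hs]
  simp only [Set.Icc_self, Set.singleton_inter_nonempty, Set.mem_singleton_iff, Nat.cast_inj,
    hf.eq_iff, Quotient.eq]

theorem exists_hasCover [Finite V] (G : SimpleGraph V) :
    ∃ k, HasCover IsEquivalenceGraph G k := by
  classical
  obtain ⟨k, ⟨e⟩⟩ := Finite.exists_equiv_fin G.edgeSet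
  refine ⟨k, fun i => fromEdgeSet {((e.symm i : G.edgeSet) : Sym2 V)}, fun i => ?_, ?_⟩
  · obtain ⟨⟨a, b⟩, hx⟩ := Sym2.mk_surjective ((e.symm i : G.edgeSet) : Sym2 V)
    · change IsEquivalenceGraph (fromEdgeSet {((e.symm i : G.edgeSet) : Sym2 V)})
      rw [← hx]
      refine ⟨Setoid.ker (fun v => if v = b then a else v), fun u v => ?_⟩
      simp only [fromEdgeSet_adj, Set.mem_singleton_iff, Function.uncurry_apply_pair, Sym2.eq_iff, Setoid.ker_def]
      grind
  · ext u v
    simp only [iSup_adj, fromEdgeSet_adj, Set.mem_singleton_iff]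
    constructor
    · rintro ⟨i, h, -⟩
      rw [← mem_edgeSet, h]
      exact (e.symm i).2
    · intro h
      exact ⟨e ⟨s(u, v), h⟩, by simp, h.ne⟩

theorem hasCover_equivalenceCoveringNumber [Finite V] (G : SimpleGraph V) :
    HasCover IsEquivalenceGraph G (equivalenceCoveringNumber G) :=
  Nat.sInf_mem (exists_hasCover G)

theorem hasCover_trackNumber [Finite V] (G : SimpleGraph V) :
    HasCover IsIntervalGraph G (trackNumber G) := by
  obtain ⟨k, H, h, h'⟩ := exists_hasCover G
  exact Nat.sInf_mem (s := {k | HasCover IsIntervalGraph G k}) ⟨k, H, fun i => (h i).isIntervalGraph, h'⟩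

theorem hasCover_chordalCoveringNumber [Finite V] (G : SimpleGraph V) :
    HasCover IsChordal G (chordalCoveringNumber G) := by
  obtain ⟨k, H, h, h'⟩ := exists_hasCover G
  exact Nat.sInf_mem (s := {k | HasCover IsChordal G k}) ⟨k, H, fun i => (h i).isChordal, h'⟩

theorem exists_isThreeSuitable_suitableNumber (n : ℕ) :
    ∃ σ : Fin (suitableNumber n) → LinearOrder (Fin n), IsThreeSuitable σ := by
  refine Nat.sInf_mem (s := {k | ∃ σ : Fin k → LinearOrder (Fin n), IsThreeSuitable σ}) ?_
  refine ⟨n, fun i => LinearOrder.lift' (fun j : Fin n => if j = i then n else (j : ℕ)) ?_, ?_⟩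
  · intro x y h
    have := x.2
    have := y.2
    simp only at h
    split_ifs at h <;> omega
  · intro a b c hab hac _
    refine ⟨a, ?_, ?_⟩
    · change (if b = a then n else (b : ℕ)) < (if a = a then n else (a : ℕ))
      simp [hab.symm]
    · change (if c = a then n else (c : ℕ)) < (if a = a then n else (a : ℕ))
      simp [hac.symm]

end LineCover

/-! Lower bound: chordal graphs (Dirac) and interval graphs have perfect elimination orderings. Let
`k` such graphs cover $L(G)$, and order the vertices of $G$, so that each edge has a lower and an
upper end. In each covering graph the later neighbours of an edge `e` are pairwise adjacent in
$L(G)$; by `star_or_triangle` they all contain the upper end of `e`, or all contain its lower end,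
or number at most two. This gives each edge a type vector, one of $3^k$. Call two edges consecutive
if the upper end of one is the lower end of the other. Among edges with equal type vectors, each has
at most two later consecutive neighbours per covering graph, so $2(2k)+1$ further colours separate
consecutive edges (`exists_coloring_of_outdegree_le`). As for shift graphs, assigning to a vertex
the set of colours of its upward edges is a proper colouring of $G$, whence `chromaticBound`. Upper
bound: colour $G$ properly and take a 3-suitable family of orders of the colours. Each order groups
the edges by their end of larger colour, which is an equivalence graph, and suitability makes these
graphs cover $L(G)$. -/

namespace LineCover

open SimpleGraph

variable {V : Type*}

/-! ### Simplicial vertices and perfect elimination orderings -/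

/-- The vertex `z` is simplicial in the subgraph induced by `W`. -/
def IsSimplicialIn (G : SimpleGraph V) (W : Finset V) (z : V) : Prop :=
  ∀ a ∈ W, ∀ b ∈ W, G.Adj z a → G.Adj z b → a ≠ b → G.Adj a b

/-- Every nonempty finite set of vertices contains a vertex that is simplicial in the subgraph it
induces. -/
def HasSimplicialVertices (G : SimpleGraph V) : Prop :=
  ∀ W : Finset V, W.Nonempty → ∃ z ∈ W, IsSimplicialIn G W z

theorem cycleGraph_adj_iff {n : ℕ} (hn : 2 ≤ n) (a b : Fin n) :
    (cycleGraph n).Adj a b ↔ a.val + 1 = b.val ∨ b.val + 1 = a.val ∨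
      (a.val = 0 ∧ b.val + 1 = n) ∨ (b.val = 0 ∧ a.val + 1 = n) := by
  rw [cycleGraph_adj']
  have ha := a.2
  have hb := b.2
  rcases lt_trichotomy a.val b.val with h | h | h
  · rw [Fin.coe_sub_iff_lt.2 h, Fin.coe_sub_iff_le.2 h.le]
    omega
  · rw [Fin.coe_sub_iff_le.2 h.le, Fin.coe_sub_iff_le.2 h.ge]
    omega
  · rw [Fin.coe_sub_iff_lt.2 h, Fin.coe_sub_iff_le.2 h.le]
    omega

/-- In a chordal graph, two neighbours of `v` that are joined by a path whose interior consists of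
non-neighbours of `v` are adjacent. -/
theorem IsChordal.adj_of_path {G : SimpleGraph V} (hG : IsChordal G) {v x y : V} {A : Set V}
    (hA : ∀ a ∈ A, a ≠ v ∧ ¬ G.Adj v a) (hx : G.Adj v x) (hy : G.Adj v y) (hxy : x ≠ y)
    (hp : ∃ m, ∃ f : ℕ → V, f 0 = x ∧ f m = y ∧ (∀ i < m, G.Adj (f i) (f (i + 1))) ∧
      ∀ i, 0 < i → i < m → f i ∈ A) : G.Adj x y := by
  classical
  by_contra hn
  -- A shortest such path has no chords, so together with `v` it forms an induced cycle.
  obtain ⟨f, f0, fm, fadj, fA⟩ := Nat.find_spec hp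
  have hmin := fun k => Nat.find_min hp (m := k)
  generalize Nat.find hp = m at *
  have key : ∀ i j, i + 1 < j → j ≤ m → ¬ G.Adj (f i) (f j) := by
    intro i j hij hjm hadj
    refine hmin (m - (j - i - 1)) (by omega)
      ⟨fun t => if t ≤ i then f t else f (t + (j - i - 1)), by simpa using f0, ?_, ?_, ?_⟩
    · dsimp only
      rw [if_neg (by omega)]
      rw [← fm]
      congr 1
      omega
    · intro t ht
      rcases lt_trichotomy t i with h | h | h
      · dsimp only
        rw [if_pos h.le, if_pos (by omega)]
        exact fadj t (by omega)
      · subst h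
        dsimp only
        rw [if_pos le_rfl, if_neg (by omega)]
        rwa [show t + 1 + (j - t - 1) = j by omega]
      · dsimp only
        rw [if_neg (by omega), if_neg (by omega)]
        rw [show t + 1 + (j - i - 1) = t + (j - i - 1) + 1 by omega]
        exact fadj _ (by omega)
    · intro t h0 ht
      dsimp only
      split_ifs with h
      · exact fA t h0 (by omega)
      · exact fA _ (by omega) (by omega)
  have hm0 : m ≠ 0 := by
    rintro rfl
    exact hxy (f0.symm.trans fm)
  have hm1 : m ≠ 1 := by
    rintro rfl
    exact hn (by simpa [f0, fm] using fadj 0 one_pos)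
  have hne : ∀ i j, i < j → j ≤ m → f i ≠ f j := by
    intro i j hij hjm h
    rcases hjm.lt_or_eq with hj | rfl
    · exact key i (j + 1) (by omega) hj (h ▸ fadj j hj)
    · rcases Nat.eq_zero_or_pos i with rfl | hi
      · exact hxy (f0.symm.trans (h.trans fm))
      · exact (hA _ (fA i hi hij)).2 (by rw [h, fm]; exact hy)
  have hvne : ∀ i ≤ m, f i ≠ v := by
    intro i hi h
    rcases Nat.eq_zero_or_pos i with rfl | hi0
    · exact hx.ne (h.symm.trans f0)
    · rcases hi.lt_or_eq with him | rfl
      · exact (hA _ (fA i hi0 him)).1 h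
      · exact hy.ne (h.symm.trans fm)
  have hvadj : ∀ i ≤ m, (G.Adj v (f i) ↔ i = 0 ∨ i = m) := by
    intro i hi
    constructor
    · intro h
      by_contra hc
      exact (hA _ (fA i (by omega) (by omega))).2 h
    · rintro (rfl | rfl)
      · rwa [f0]
      · rwa [fm]
  have hfadj : ∀ i ≤ m, ∀ j ≤ m, (G.Adj (f i) (f j) ↔ i + 1 = j ∨ j + 1 = i) := by
    intro i hi j hj
    constructor
    · intro h
      by_contra hc
      rcases lt_trichotomy i j with hij | rfl | hij
      · exact key i j (by omega) hj h
      · exact h.ne rfl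
      · exact key j i (by omega) hi h.symm
    · rintro (rfl | rfl)
      · exact fadj i (by omega)
      · exact (fadj j (by omega)).symm
  -- The last position of the cycle is `v`; its length `m + 2` is at least four because `x` and `y`
  -- are distinct and not adjacent.
  let g : Fin (m + 2) → V := fun i => if i.val ≤ m then f i.val else v
  refine (hG (m + 2) (by omega)).false ⟨⟨g, ?_⟩, ?_⟩
  · intro a b hab
    have ha := a.2
    have hb := b.2
    ext
    by_contra hc
    simp only [g] at hab
    split_ifs at hab with h1 h2 h2
    · rcases Nat.lt_or_gt_of_ne hc with h | h
      · exact hne _ _ h h2 hab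
      · exact hne _ _ h h1 hab.symm
    · exact hvne _ h1 hab
    · exact hvne _ h2 hab.symm
    · omega
  · intro a b
    have ha := a.2
    have hb := b.2
    rw [cycleGraph_adj_iff (by omega)]
    change G.Adj (if a.val ≤ m then f a.val else v) (if b.val ≤ m then f b.val else v) ↔ _
    split_ifs with h1 h2 h2
    · rw [hfadj _ h1 _ h2]
      omega
    · rw [G.adj_comm, hvadj _ h1]
      omega
    · rw [hvadj _ h2]
      omega
    · simp only [SimpleGraph.irrefl, false_iff]
      omega

/-- Dirac's theorem: if `v` is not adjacent to all other vertices of `W`, then some vertex that is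
simplicial in `W` is not adjacent to `v`. -/
theorem IsChordal.exists_isSimplicialIn_not_adj {G : SimpleGraph V} (hG : IsChordal G)
    (W : Finset V) (v : V) (hv : v ∈ W) (h : ∃ w ∈ W, w ≠ v ∧ ¬ G.Adj v w) :
    ∃ z ∈ W, z ≠ v ∧ ¬ G.Adj v z ∧ IsSimplicialIn G W z := by
  classical
  induction W using Finset.strongInduction generalizing v with
  | H W ih =>
  obtain ⟨w, hwW, hwv, hvw⟩ := h
  let A : Set V := {a | a ∈ W ∧ a ≠ v ∧ ¬ G.Adj v a}
  let R : V → V → Prop := fun a b => G.Adj a b ∧ b ∈ A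
  -- The component of `w` among the non-neighbours of `v` in `W`.
  let C : Set V := {c | Relation.ReflTransGen R w c}
  have hCA : ∀ c ∈ C, c ∈ A := by
    intro c hc
    rcases Relation.ReflTransGen.cases_tail hc with rfl | ⟨_, _, h⟩
    exacts [⟨hwW, hwv, hvw⟩, h.2]
  have hCadj : ∀ c ∈ C, ∀ a ∈ W, G.Adj c a → a ∈ C ∨ G.Adj v a := by
    intro c hc a ha hca
    by_cases hva : G.Adj v a
    · exact .inr hva
    · refine .inl (Relation.ReflTransGen.tail hc ⟨hca, ha, ?_, hva⟩)
      rintro rfl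
      exact (hCA c hc).2.2 hca.symm
  have hRsymm : ∀ a ∈ C, ∀ b ∈ C, Relation.ReflTransGen R a b := by
    have h1 : ∀ a ∈ C, Relation.ReflTransGen R a w := by
      intro a ha
      induction ha with
      | refl => exact .refl
      | tail hb hbc ih => exact ih.head ⟨hbc.1.symm, hCA _ hb⟩
    exact fun a ha b hb => (h1 a ha).trans hb
  have hclique : ∀ x y, G.Adj v x → G.Adj v y → x ≠ y → (∃ c ∈ C, G.Adj c x) →
      (∃ c ∈ C, G.Adj c y) → G.Adj x y := by
    rintro x y hx hy hxy ⟨c, hc, hcx⟩ ⟨d, hd, hdy⟩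
    have hpath : ∃ m, ∃ f : ℕ → V, f 0 = x ∧ f m = d ∧ (∀ i < m, G.Adj (f i) (f (i + 1))) ∧
        ∀ i, 0 < i → i ≤ m → f i ∈ A := by
      have := hRsymm c hc d hd
      clear hdy hd
      induction this with
      | refl =>
        refine ⟨1, fun i => if i = 0 then x else c, by simp, by simp, ?_, ?_⟩
        · intro i hi
          obtain rfl : i = 0 := by omega
          simpa using hcx.symm
        · intro i hi _
          simpa [hi.ne'] using hCA c hc
      | @tail d e _ hde ih =>
        obtain ⟨m, f, f0, fm, fadj, fA⟩ := ih
        refine ⟨m + 1, fun i => if i ≤ m then f i else e, by simpa, by simp, ?_, ?_⟩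
        · intro i hi
          rcases Nat.lt_succ_iff_lt_or_eq.1 hi with h | rfl
          · simpa [h.le, Nat.succ_le_iff.2 h] using fadj i h
          · simpa [fm] using hde.1
        · intro i hi him
          dsimp only
          split_ifs with h
          · exact fA i hi h
          · exact hde.2
    obtain ⟨m, f, f0, fm, fadj, fA⟩ := hpath
    refine hG.adj_of_path (A := A) (fun a ha => ha.2) hx hy hxy
      ⟨m + 1, fun i => if i ≤ m then f i else y, by simpa, by simp, ?_, ?_⟩
    · intro i hi
      rcases Nat.lt_succ_iff_lt_or_eq.1 hi with h | rfl
      · simpa [h.le, Nat.succ_le_iff.2 h] using fadj i h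
      · simpa [fm] using hdy
    · intro i hi him
      simpa [Nat.lt_succ_iff.1 him] using fA i hi (by omega)
  -- the component of `w` together with its neighbourhood
  let W' : Finset V := W.filter fun a => a ∈ C ∨ (G.Adj v a ∧ ∃ c ∈ C, G.Adj c a)
  have hW'W : W' ⊂ W := by
    refine (Finset.ssubset_iff_of_subset (Finset.filter_subset _ _)).2 ⟨v, hv, fun h => ?_⟩
    rcases (Finset.mem_filter.1 h).2 with h | h
    · exact (hCA v h).2.1 rfl
    · exact h.1.ne rfl
  have hCW' : ∀ c ∈ C, c ∈ W' := fun c hc => Finset.mem_filter.2 ⟨(hCA c hc).1, .inl hc⟩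
  -- A vertex of `C` has all its neighbours in `W` already in `W'`, so being simplicial in `W'`
  -- suffices.
  have lift : ∀ z ∈ C, IsSimplicialIn G W' z →
      ∃ z ∈ W, z ≠ v ∧ ¬ G.Adj v z ∧ IsSimplicialIn G W z := by
    intro z hz hs
    have hmem : ∀ a ∈ W, G.Adj z a → a ∈ W' := fun a ha hza =>
      Finset.mem_filter.2 ⟨ha, (hCadj z hz a ha hza).imp_right fun h => ⟨h, z, hz, hza⟩⟩
    exact ⟨z, (hCA z hz).1, (hCA z hz).2.1, (hCA z hz).2.2, fun a ha b hb hza hzb =>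
      hs a (hmem a ha hza) b (hmem b hb hzb) hza hzb⟩
  -- If `W'` is not a clique, induction is used twice to get two non-adjacent simplicial vertices of
  -- `W'`. By `hclique` they cannot both be neighbours of `v`, so one lies in `C`.
  by_cases hcl : ∀ a ∈ W', ∀ b ∈ W', a ≠ b → G.Adj a b
  · exact lift w .refl fun a ha b hb _ _ => hcl a ha b hb
  · push Not at hcl
    obtain ⟨a, ha, b, hb, hab, hnab⟩ := hcl
    obtain ⟨z, hz, hza, hnaz, hzs⟩ := ih W' hW'W a ha ⟨b, hb, hab.symm, hnab⟩
    rcases (Finset.mem_filter.1 hz).2 with hzC | hzS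
    · exact lift z hzC hzs
    · obtain ⟨y, hy, hyz, hnzy, hys⟩ := ih W' hW'W z hz ⟨a, ha, hza.symm, fun h => hnaz h.symm⟩
      rcases (Finset.mem_filter.1 hy).2 with hyC | hyS
      · exact lift y hyC hys
      · exact absurd (hclique z y hzS.1 hyS.1 hyz.symm hzS.2 hyS.2) hnzy

theorem IsChordal.hasSimplicialVertices {G : SimpleGraph V} (hG : IsChordal G) :
    HasSimplicialVertices G := by
  intro W ⟨w, hw⟩
  by_cases h : ∃ v ∈ W, ∃ w ∈ W, w ≠ v ∧ ¬ G.Adj v w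
  · obtain ⟨v, hv, h⟩ := h
    obtain ⟨z, hz, -, -, hs⟩ := hG.exists_isSimplicialIn_not_adj W v hv h
    exact ⟨z, hz, hs⟩
  · push Not at h
    exact ⟨w, hw, fun a ha b hb _ _ hab => h a ha b hb hab.symm⟩

/-- The interval of `W` that ends first works: every interval of `W` meeting it contains its right
endpoint. -/
theorem IsIntervalGraph.hasSimplicialVertices {G : SimpleGraph V} (hG : IsIntervalGraph G) :
    HasSimplicialVertices G := by
  obtain ⟨l, r, hlr, h⟩ := hG
  intro W hW
  obtain ⟨z, hz, hmin⟩ := W.exists_min_image r hW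
  have hmem : ∀ a ∈ W, G.Adj z a → r z ∈ Set.Icc (l a) (r a) := by
    intro a ha hza
    obtain ⟨t, ht, ht'⟩ := ((h z a).1 hza).2
    exact ⟨ht'.1.trans ht.2, hmin a ha⟩
  exact ⟨z, hz, fun a ha b hb hza hzb hab =>
    (h a b).2 ⟨hab, r z, hmem a ha hza, hmem b hb hzb⟩⟩

/-- A perfect elimination ordering. -/
theorem HasSimplicialVertices.exists_ranking [Finite V] {G : SimpleGraph V}
    (hG : HasSimplicialVertices G) : ∃ r : V → ℕ, r.Injective ∧
      ∀ a b c, r a < r b → r a < r c → b ≠ c → G.Adj a b → G.Adj a c → G.Adj b c := by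
  classical
  have key : ∀ W : Finset V, ∃ r : V → ℕ, Set.InjOn r W ∧ ∀ a ∈ W, ∀ b ∈ W, ∀ c ∈ W,
      r a < r b → r a < r c → b ≠ c → G.Adj a b → G.Adj a c → G.Adj b c := by
    intro W
    induction W using Finset.strongInduction with
    | H W ih =>
    rcases W.eq_empty_or_nonempty with rfl | hW
    · exact ⟨fun _ => 0, by simp, by simp⟩
    · obtain ⟨z, hz, hs⟩ := hG W hW
      obtain ⟨r, hr, hr'⟩ := ih (W.erase z) (Finset.erase_ssubset hz)
      -- The simplicial vertex is eliminated before all others.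
      refine ⟨fun a => if a = z then 0 else r a + 1, ?_, ?_⟩
      · intro a ha b hb hab
        by_cases h1 : a = z <;> by_cases h2 : b = z <;> simp [h1, h2] at hab ⊢
        exact hr (by simpa [h1] using ha) (by simpa [h2] using hb) hab
      · intro a ha b hb c hc hab hac hbc h1 h2
        have hbz : b ≠ z := by
          rintro rfl
          simp at hab
        have hcz : c ≠ z := by
          rintro rfl
          simp at hac
        by_cases haz : a = z
        · subst haz
          exact hs b hb c hc h1 h2 hbc
        · simp only [haz, hbz, hcz, if_false, Nat.add_lt_add_iff_right] at hab hac
          exact hr' a (by simp [haz, ha]) b (by simp [hbz, hb]) c (by simp [hcz, hc])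
            hab hac hbc h1 h2
  have := Fintype.ofFinite V
  obtain ⟨r, hr, hr'⟩ := key Finset.univ
  exact ⟨r, by simpa [Set.injOn_univ] using hr, fun a b c => hr' a (by simp) b (by simp) c (by simp)⟩

/-! ### Colouring relations of bounded out-degree -/

/-- A relation with all out-degrees at most `d` can be properly coloured with `2 * d + 1` colours. -/
theorem exists_coloring_of_outdegree_le {α : Type*} [Finite α] (R : α → α → Prop) (d : ℕ)
    (hR : ∀ a, ∀ S : Finset α, (∀ b ∈ S, R a b) → S.card ≤ d) :
    ∃ c : α → Fin (2 * d + 1), ∀ a b, a ≠ b → R a b → c a ≠ c b := by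
  classical
  have key : ∀ W : Finset α, ∃ c : α → Fin (2 * d + 1),
      ∀ a ∈ W, ∀ b ∈ W, a ≠ b → R a b → c a ≠ c b := by
    intro W
    induction W using Finset.strongInduction with
    | H W ih =>
    rcases W.eq_empty_or_nonempty with rfl | hW
    · exact ⟨fun _ => 0, by simp⟩
    -- Average in-degree equals average out-degree, so some `v` has in-degree at most `d` within
    -- `W`; at most `2 * d` colours are then forbidden at `v`.
    obtain ⟨v, hv, hvd⟩ : ∃ v ∈ W, (W.filter fun a => R a v).card ≤ d := by
      by_contra! hc
      have h1 : ∑ a ∈ W, (W.filter fun b => R a b).card ≤ ∑ _ ∈ W, d :=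
        Finset.sum_le_sum fun a _ => hR a _ fun b hb => (Finset.mem_filter.1 hb).2
      have h2 : ∑ _ ∈ W, d < ∑ b ∈ W, (W.filter fun a => R a b).card :=
        Finset.sum_lt_sum_of_nonempty hW hc
      have h3 := Finset.sum_card_bipartiteAbove_eq_sum_card_bipartiteBelow (s := W) (t := W) R
      simp only [Finset.bipartiteAbove, Finset.bipartiteBelow] at h3
      omega
    obtain ⟨c, hc⟩ := ih (W.erase v) (Finset.erase_ssubset hv)
    let F := ((W.filter fun a => R a v) ∪ (W.filter fun b => R v b)).image c
    have hF : F.card ≤ d + d := Finset.card_image_le.trans ((Finset.card_union_le _ _).trans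
      (add_le_add hvd (hR v _ fun b hb => (Finset.mem_filter.1 hb).2)))
    obtain ⟨x, hx⟩ : ∃ x, x ∉ F := by
      by_contra! h
      have := Finset.card_le_card (fun x _ => h x : (Finset.univ : Finset (Fin (2 * d + 1))) ⊆ F)
      simp only [Finset.card_univ, Fintype.card_fin] at this
      omega
    refine ⟨Function.update c v x, fun a ha b hb hab h => ?_⟩
    by_cases hav : a = v
    · subst hav
      rw [Function.update_self, Function.update_of_ne hab.symm]
      rintro rfl
      exact hx (Finset.mem_image_of_mem _ (by simp [hb, h]))
    · by_cases hbv : b = v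
      · subst hbv
        rw [Function.update_self, Function.update_of_ne hab]
        rintro rfl
        exact hx (Finset.mem_image_of_mem _ (by simp [ha, h]))
      · rw [Function.update_of_ne hav, Function.update_of_ne hbv]
        exact hc a (by simp [hav, ha]) b (by simp [hbv, hb]) hab h
  have := Fintype.ofFinite α
  obtain ⟨c, hc⟩ := key Finset.univ
  exact ⟨c, fun a b => hc a (by simp) b (by simp)⟩

/-! ### Bounding the chromatic number by covers of the line graph -/

/-- The endpoints of the edges of a finite graph, ordered along a ranking of the vertices. -/
theorem exists_endpoints [Finite V] (G : SimpleGraph V) :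
    ∃ (ord : V → ℕ) (lo hi : G.edgeSet → V), (∀ e, e.val = s(lo e, hi e)) ∧
      ∀ e, ord (lo e) < ord (hi e) := by
  obtain ⟨n, ⟨f⟩⟩ := Finite.exists_equiv_fin V
  have hinj : Function.Injective fun v => (f v : ℕ) := Fin.val_injective.comp f.injective
  have : ∀ e : G.edgeSet, ∃ p : V × V, (e : Sym2 V) = s(p.1, p.2) ∧ (f p.1 : ℕ) < f p.2 := by
    rintro ⟨e, he⟩
    induction e using Sym2.ind with
    | _ x y =>
    have hne : (f x : ℕ) ≠ f y := fun h => G.ne_of_adj he (hinj h)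
    rcases hne.lt_or_gt with h | h
    · exact ⟨(x, y), rfl, h⟩
    · exact ⟨(y, x), Sym2.eq_swap, h⟩
  choose p hp hp' using this
  exact ⟨fun v => f v, fun e => (p e).1, fun e => (p e).2, hp, hp'⟩

theorem lineGraph_adj_mk {G : SimpleGraph V} {e f : G.edgeSet} {a b c d : V}
    (he : (e : Sym2 V) = s(a, b)) (hf : (f : Sym2 V) = s(c, d)) :
    G.lineGraph.Adj e f ↔ e ≠ f ∧ (a = c ∨ a = d ∨ b = c ∨ b = d) := by
  rw [lineGraph_adj_iff_exists]
  simp only [he, hf, Sym2.mem_iff, or_and_right, exists_or, exists_eq_left, or_assoc]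

/-- A bound for the chromatic number of a graph whose line graph is covered by `k` chordal
graphs. -/
def chromaticBound (k : ℕ) : ℕ :=
  2 ^ (3 ^ k * (2 * (k * 2) + 1))

theorem chromaticBound_mono : Monotone chromaticBound := by
  intro a b h
  unfold chromaticBound
  gcongr <;> norm_num

/-- If later neighbours of an edge in an elimination ordering form a clique of the line graph, then
they all share the upper endpoint of the edge, or all share its lower endpoint, or there are at most
two of them. -/
theorem star_or_triangle {E : Type*} {lo hi : E → V} {e : E} {N : E → Prop}
    (hinj : ∀ f g, lo f = lo g → hi f = hi g → f = g)
    (hswap : ∀ f g, lo f = hi g → hi f = lo g → False)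
    (hloop : ∀ f, lo f ≠ hi f)
    (hne : ∀ f, N f → f ≠ e)
    (hN : ∀ f, N f → lo e = lo f ∨ lo e = hi f ∨ hi e = lo f ∨ hi e = hi f)
    (hcl : ∀ f g, N f → N g → f ≠ g → lo f = lo g ∨ lo f = hi g ∨ hi f = lo g ∨ hi f = hi g) :
    (∀ f, N f → lo f = hi e ∨ hi f = hi e) ∨ (∀ f, N f → lo f = lo e ∨ hi f = lo e) ∨
      ∃ f g, ∀ h, N h → h = f ∨ h = g := by
  -- Here `f` misses the upper end of `e` and `g` misses the lower end, so `e`, `f`, `g` are the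
  -- sides of a triangle. An edge meeting all three sides joins two corners, so no further `h`
  -- exists.
  by_contra! hc
  obtain ⟨⟨f, hf, hf1, hf2⟩, ⟨g, hg, hg1, hg2⟩, h⟩ := hc
  obtain ⟨h, hh, hhf, hhg⟩ := h f g
  have := hN f hf
  have := hN g hg
  have := hN h hh
  have := hne h hh
  have := hcl f g hf hg (by grind)
  have := hcl f h hf hh hhf.symm
  have := hcl g h hg hh hhg.symm
  have := hloop f
  have := hloop g
  have := hloop h
  have := hloop e
  have := hinj f h
  have := hinj g h
  have := hinj h e
  have := hswap f h
  have := hswap g h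
  have := hswap h e
  grind

theorem colorable_of_hasCover [Finite V] {G : SimpleGraph V} {k : ℕ}
    (hcov : HasCover HasSimplicialVertices G.lineGraph k) : G.Colorable (chromaticBound k) := by
  classical
  obtain ⟨H, hH, hsup⟩ := hcov
  have hle : ∀ i e f, (H i).Adj e f → G.lineGraph.Adj e f := by
    intro i e f h
    rw [← hsup, iSup_adj]
    exact ⟨i, h⟩
  have hcover : ∀ e f, G.lineGraph.Adj e f → ∃ i, (H i).Adj e f := by
    intro e f h
    rwa [← hsup, iSup_adj] at h
  obtain ⟨ord, lo, hi, hlohi, hord⟩ := exists_endpoints G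
  have hadj : ∀ e f, G.lineGraph.Adj e f ↔
      e ≠ f ∧ (lo e = lo f ∨ lo e = hi f ∨ hi e = lo f ∨ hi e = hi f) :=
    fun e f => lineGraph_adj_mk (hlohi e) (hlohi f)
  have hinj : ∀ f g, lo f = lo g → hi f = hi g → f = g := by
    intro f g h1 h2
    exact Subtype.ext (by rw [hlohi f, hlohi g, h1, h2])
  choose r hrinj hr using fun i => (hH i).exists_ranking
  let N : G.edgeSet → Fin k → G.edgeSet → Prop := fun e i f => (H i).Adj e f ∧ r i e < r i f
  have htype : ∀ e i, ∃ t : Fin 3,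
      (t = 0 → ∀ f, N e i f → lo f = hi e ∨ hi f = hi e) ∧
      (t = 1 → ∀ f, N e i f → lo f = lo e ∨ hi f = lo e) ∧
      (t = 2 → ∃ f g, ∀ h, N e i h → h = f ∨ h = g) := by
    intro e i
    have := star_or_triangle (e := e) (N := N e i) hinj
      (fun f g h1 h2 => by
        have := hord f
        have := hord g
        rw [h1, h2] at *
        omega)
      (fun f h => (hord f).ne (congrArg ord h)) (fun f hf => hf.1.ne.symm)
      (fun f hf => ((hadj _ _).1 (hle i _ _ hf.1)).2)
      (fun f g hf hg hfg => ((hadj _ _).1 (hle i _ _ (hr i e f g hf.2 hg.2 hfg hf.1 hg.1))).2)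
    rcases this with h | h | h
    · exact ⟨0, by simpa using h⟩
    · exact ⟨1, by simpa using h⟩
    · exact ⟨2, by simpa using h⟩
  choose T hT0 hT1 hT2 using htype
  -- Whole type vectors are compared, not just entry `i`, so that a single colouring serves all `i`.
  let R : Fin k → G.edgeSet → G.edgeSet → Prop := fun i e f =>
    T e = T f ∧ (hi e = lo f ∨ hi f = lo e) ∧ N e i f
  have hRi : ∀ i e, ∃ f g, ∀ h, R i e h → h = f ∨ h = g := by
    intro i e
    by_cases ht : T e i = 2
    · obtain ⟨f, g, hfg⟩ := hT2 e i ht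
      exact ⟨f, g, fun h hh => hfg h hh.2.2⟩
    -- In types 0 and 1 the out-neighbour is unique. In type 0, `f` and `g` both have lower end `hi
    -- e`; as `g` is also a later neighbour of `f`, which has type 0, it contains `hi f`, so `f =
    -- g`. Type 1 is the mirror image.
    suffices h : ∀ f g, R i e f → R i e g → r i f < r i g → False by
      by_cases hex : ∃ f, R i e f
      · obtain ⟨f, hf⟩ := hex
        refine ⟨f, f, fun g hg => .inl ?_⟩
        rcases lt_trichotomy (r i f) (r i g) with h' | h' | h'
        · exact (h f g hf hg h').elim
        · exact (hrinj i h').symm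
        · exact (h g f hg hf h').elim
      · exact ⟨e, e, fun f hf => absurd ⟨f, hf⟩ hex⟩
    rintro f g ⟨hTf, hcf, hNf⟩ ⟨hTg, hcg, hNg⟩ hfg
    have hne : f ≠ g := by
      rintro rfl
      exact hfg.ne rfl
    have hNfg : N f i g := ⟨hr i e f g hNf.2 hNg.2 hne hNf.1 hNg.1, hfg⟩
    have o1 := hord e
    have o2 := hord f
    have o3 := hord g
    have hfi : T f i = T e i := by rw [hTf]
    have h3 : T e i = 0 ∨ T e i = 1 := by
      generalize T e i = t at ht
      revert ht
      revert t
      decide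
    rcases h3 with h0 | h1
    · have a1 := hT0 e i h0 f hNf
      have a2 := hT0 e i h0 g hNg
      have a3 := hT0 f i (hfi.trans h0) g hNfg
      have := hinj f g
      grind
    · have a1 := hT1 e i h1 f hNf
      have a2 := hT1 e i h1 g hNg
      have a3 := hT1 f i (hfi.trans h1) g hNfg
      have := hinj f g
      grind
  obtain ⟨c, hc⟩ := exists_coloring_of_outdegree_le (fun e f => ∃ i, R i e f) (k * 2) (by
    intro e S hS
    choose a b hab using fun i => hRi i e
    have hsub : S ⊆ (Finset.univ : Finset (Fin k)).biUnion fun i => {a i, b i} := by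
      intro f hf
      obtain ⟨i, hi⟩ := hS f hf
      simpa using ⟨i, hab i f hi⟩
    have := Finset.card_biUnion_le_card_mul (Finset.univ : Finset (Fin k))
      (fun i => {a i, b i}) 2 (fun i _ => Finset.card_le_two)
    simpa using (Finset.card_le_card hsub).trans this)
  have hcons : ∀ e f, hi e = lo f → T e = T f → c e ≠ c f := by
    intro e f hef hTef
    have hne : e ≠ f := by
      rintro rfl
      exact (hord e).ne (congrArg ord hef.symm)
    obtain ⟨i, hi'⟩ := hcover e f ((hadj e f).2 ⟨hne, by tauto⟩)
    rcases lt_trichotomy (r i e) (r i f) with h | h | h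
    · exact hc e f hne ⟨i, hTef, .inl hef, hi', h⟩
    · exact absurd (hrinj i h) hne
    · exact (hc f e hne.symm ⟨i, hTef.symm, .inr hef, hi'.symm, h⟩).symm
  have := Fintype.ofFinite G.edgeSet
  -- The colour of an edge `e` lies in the set of its lower end; if it lay in that of its upper end,
  -- an edge starting there would have the same colour, against `hcons`.
  let φ : V → Finset ((Fin k → Fin 3) × Fin (2 * (k * 2) + 1)) := fun v =>
    (Finset.univ.filter fun e => lo e = v).image fun e => (T e, c e)
  have hφ : ∀ e, φ (lo e) ≠ φ (hi e) := by
    intro e h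
    have h1 : (T e, c e) ∈ φ (lo e) := Finset.mem_image_of_mem _ (by simp)
    rw [h] at h1
    obtain ⟨f, hf, hfe⟩ := Finset.mem_image.1 h1
    obtain ⟨h2, h3⟩ := Prod.mk.inj hfe
    exact hcons e f (Finset.mem_filter.1 hf).2.symm h2.symm h3.symm
  have C : G.Coloring (Finset ((Fin k → Fin 3) × Fin (2 * (k * 2) + 1))) :=
    Coloring.mk φ (by
      intro x y hxy h
      have he := hlohi ⟨s(x, y), hxy⟩
      have := hφ ⟨s(x, y), hxy⟩
      rcases Sym2.eq_iff.1 he with ⟨h1, h2⟩ | ⟨h1, h2⟩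
      · rw [← h1, ← h2] at this
        exact this h
      · rw [← h1, ← h2] at this
        exact this h.symm)
  have := C.colorable
  simpa [chromaticBound] using this

theorem colorable_chi [Finite V] (G : SimpleGraph V) : G.Colorable (chi G) :=
  chromaticNumber_le_iff_colorable.1 (coe_chi G).ge

theorem chi_le_of_colorable [Finite V] {G : SimpleGraph V} {n : ℕ} (h : G.Colorable n) :
    chi G ≤ n := by
  have := h.chromaticNumber_le
  rw [← coe_chi] at this
  exact_mod_cast this

theorem chi_le_of_chordalCoveringNumber_le [Finite V] {G : SimpleGraph V} {k : ℕ}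
    (h : chordalCoveringNumber G.lineGraph ≤ k) : chi G ≤ chromaticBound k := by
  obtain ⟨H, hH, hsup⟩ := hasCover_chordalCoveringNumber G.lineGraph
  exact (chi_le_of_colorable
    (colorable_of_hasCover ⟨H, fun i => (hH i).hasSimplicialVertices, hsup⟩)).trans
      (chromaticBound_mono h)

theorem chi_le_of_trackNumber_le [Finite V] {G : SimpleGraph V} {k : ℕ}
    (h : trackNumber G.lineGraph ≤ k) : chi G ≤ chromaticBound k := by
  obtain ⟨H, hH, hsup⟩ := hasCover_trackNumber G.lineGraph
  exact (chi_le_of_colorable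
    (colorable_of_hasCover ⟨H, fun i => (hH i).hasSimplicialVertices, hsup⟩)).trans
      (chromaticBound_mono h)

theorem trackNumber_le_equivalenceCoveringNumber [Finite V] (G : SimpleGraph V) :
    trackNumber G ≤ equivalenceCoveringNumber G := by
  obtain ⟨H, hH, hsup⟩ := hasCover_equivalenceCoveringNumber G
  exact Nat.sInf_le ⟨H, fun i => (hH i).isIntervalGraph, hsup⟩

/-! ### Equivalence covers from suitable families of orders -/

/-- In a 3-suitable family of orders of at least three elements, any element comes after any one or
two others in some order. -/
theorem IsThreeSuitable.exists_lt_lt {n k : ℕ} {σ : Fin k → LinearOrder (Fin n)}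
    (hσ : IsThreeSuitable σ) (hn : 3 ≤ n) {a b c : Fin n} (hab : a ≠ b) (hac : a ≠ c) :
    ∃ i, (σ i).lt b a ∧ (σ i).lt c a := by
  by_cases hbc : b = c
  · subst hbc
    obtain ⟨d, hd⟩ : ∃ d, d ∉ ({a, b} : Finset (Fin n)) := by
      by_contra! h
      have h1 := Finset.card_le_card
        (fun x _ => h x : (Finset.univ : Finset (Fin n)) ⊆ {a, b})
      have h2 := Finset.card_le_two (a := a) (b := b)
      simp only [Finset.card_univ, Fintype.card_fin] at h1
      omega
    simp only [Finset.mem_insert, Finset.mem_singleton, not_or] at hd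
    obtain ⟨i, hi, -⟩ := hσ a b d hab (Ne.symm hd.1) (Ne.symm hd.2)
    exact ⟨i, hi, hi⟩
  · exact hσ a b c hab hac hbc

/-- Given a total order of the colours, the edges are partitioned by their endpoint of larger
colour. -/
theorem exists_upper_endpoint {G : SimpleGraph V} {n : ℕ} (c : G.Coloring (Fin n))
    (o : LinearOrder (Fin n)) :
    ∃ top : G.edgeSet → V, (∀ e, top e ∈ e.val) ∧
      ∀ (e : G.edgeSet) x y, e.val = s(x, y) → o.lt (c x) (c y) → top e = y := by
  have : ∀ e : G.edgeSet, ∃ t ∈ e.val, ∀ x y, e.val = s(x, y) → o.lt (c x) (c y) → t = y := by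
    rintro ⟨e, he⟩
    induction e using Sym2.ind with
    | _ x y =>
    rcases @lt_trichotomy _ o (c x) (c y) with h | h | h
    · refine ⟨y, by simp, fun a b hab hlt => ?_⟩
      rcases Sym2.eq_iff.1 hab with ⟨-, h2⟩ | ⟨rfl, rfl⟩
      · exact h2
      · exact (@lt_asymm _ o.toPreorder _ _ h hlt).elim
    · exact absurd h (c.valid he)
    · refine ⟨x, by simp, fun a b hab hlt => ?_⟩
      rcases Sym2.eq_iff.1 hab with ⟨rfl, rfl⟩ | ⟨h1, -⟩
      · exact (@lt_asymm _ o.toPreorder _ _ h hlt).elim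
      · exact h1
  choose top h1 h2 using this
  exact ⟨top, h1, h2⟩

/-- For two edges at `v`, some order puts the colour of `v` after the colours of both other ends,
which may coincide; both edges are then grouped at `v`. -/
theorem equivalenceCoveringNumber_lineGraph_le {G : SimpleGraph V} {n : ℕ}
    (hG : G.Colorable n) (hn : 3 ≤ n) :
    equivalenceCoveringNumber G.lineGraph ≤ suitableNumber n := by
  obtain ⟨c⟩ := hG
  obtain ⟨σ, hσ⟩ := exists_isThreeSuitable_suitableNumber n
  choose top hmem htop using fun i => exists_upper_endpoint c (σ i)
  refine Nat.sInf_le ⟨fun i =>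
    { Adj := fun e f => e ≠ f ∧ top i e = top i f
      symm := ⟨fun e f h => ⟨h.1.symm, h.2.symm⟩⟩
      loopless := ⟨fun e h => h.1 rfl⟩ }, fun i => ⟨Setoid.ker (top i), fun e f => Iff.rfl⟩, ?_⟩
  ext e f
  rw [iSup_adj, lineGraph_adj_iff_exists]
  constructor
  · rintro ⟨i, hne, h⟩
    exact ⟨hne, top i e, hmem i e, h ▸ hmem i f⟩
  · rintro ⟨hne, v, hve, hvf⟩
    obtain ⟨x, hx⟩ := Sym2.mem_iff_exists.1 hve
    obtain ⟨y, hy⟩ := Sym2.mem_iff_exists.1 hvf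
    have hvx : G.Adj v x := by
      have := e.2
      rwa [hx, mem_edgeSet] at this
    have hvy : G.Adj v y := by
      have := f.2
      rwa [hy, mem_edgeSet] at this
    obtain ⟨i, h1, h2⟩ := hσ.exists_lt_lt hn (c.valid hvx) (c.valid hvy)
    refine ⟨i, hne, ?_⟩
    rw [htop i e x v (hx.trans Sym2.eq_swap) h1, htop i f y v (hy.trans Sym2.eq_swap) h2]

theorem equivalenceCoveringNumber_lineGraph_le_of_chi_ne_two [Finite V] (G : SimpleGraph V)
    (h : chi G ≠ 2) : equivalenceCoveringNumber G.lineGraph ≤ suitableNumber (chi G) := by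
  rcases le_or_gt 3 (chi G) with h3 | h3
  · exact equivalenceCoveringNumber_lineGraph_le (colorable_chi G) h3
  · have h1 : G.Colorable 1 := (colorable_chi G).mono (by omega)
    obtain ⟨c⟩ := h1
    suffices h0 : HasCover IsEquivalenceGraph G.lineGraph 0 from
      (Nat.sInf_le h0).trans (Nat.zero_le _)
    refine ⟨Fin.elim0, fun i => i.elim0, ?_⟩
    ext ⟨e, he⟩ f
    induction e using Sym2.ind with
    | _ x y => exact absurd (Subsingleton.elim _ _) (c.valid he)

end LineCover

theorem mainTheorem4 :
    -- for every sequence of finite graphs whose chromatic numbers tend to infinity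
    (∀ (V : ℕ → Type u) [∀ n, Finite (V n)] (G : ∀ n, SimpleGraph (V n)),
      Filter.Tendsto (fun n => LineCover.chi (G n)) Filter.atTop Filter.atTop →
        Filter.Tendsto (fun n => LineCover.chordalCoveringNumber (G n).lineGraph)
          Filter.atTop Filter.atTop ∧
        Filter.Tendsto (fun n => LineCover.trackNumber (G n).lineGraph)
          Filter.atTop Filter.atTop) ∧
    -- the upper bound for a single finite graph
    (∀ (V : Type u) [Finite V] (G : SimpleGraph V), LineCover.chi G ≠ 2 →
      LineCover.equivalenceCoveringNumber G.lineGraph ≤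
        LineCover.suitableNumber (LineCover.chi G)) ∧
    -- for every family of finite graphs
    (∀ (ι : Type v) (V : ι → Type u) [∀ i, Finite (V i)] (G : ∀ i, SimpleGraph (V i)),
      BddAbove (Set.range fun i => LineCover.trackNumber (G i).lineGraph) ↔
        BddAbove (Set.range fun i => LineCover.chi (G i))) := by
  refine ⟨fun V _ G hG => ⟨?_, ?_⟩, fun V _ G h =>
    LineCover.equivalenceCoveringNumber_lineGraph_le_of_chi_ne_two G h, fun ι V _ G => ⟨?_, ?_⟩⟩
  · refine Filter.tendsto_atTop.2 fun b => ?_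
    filter_upwards [hG.eventually_gt_atTop (LineCover.chromaticBound b)] with n hn
    by_contra! h
    exact hn.not_ge (LineCover.chi_le_of_chordalCoveringNumber_le h.le)
  · refine Filter.tendsto_atTop.2 fun b => ?_
    filter_upwards [hG.eventually_gt_atTop (LineCover.chromaticBound b)] with n hn
    by_contra! h
    exact hn.not_ge (LineCover.chi_le_of_trackNumber_le h.le)
  · rintro ⟨b, hb⟩
    refine ⟨LineCover.chromaticBound b, ?_⟩
    rintro _ ⟨i, rfl⟩
    exact LineCover.chi_le_of_trackNumber_le (hb ⟨i, rfl⟩)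
  · rintro ⟨b, hb⟩
    -- Allowing surplus colours gives the three that are needed, even for bipartite graphs, and one
    -- bound for the whole family without comparing values of `suitableNumber`.
    refine ⟨LineCover.suitableNumber (max b 3), ?_⟩
    rintro _ ⟨i, rfl⟩
    exact (LineCover.trackNumber_le_equivalenceCoveringNumber _).trans
      (LineCover.equivalenceCoveringNumber_lineGraph_le
        ((LineCover.colorable_chi (G i)).mono ((hb ⟨i, rfl⟩).trans (le_max_left _ _)))
        (le_max_right _ _))
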